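/- Let $V$ be a compact complex manifold of dimension $n$ without boundary with a Kähler metric $g_V$, and let $R$ be a compact Riemann surface with non-empty boundary with a Kähler (i.e. conformal Hermitian) metric $g_R$, for instance $|dw|^2$ on a cylinder. Let $g=(g_{\alpha\bar\beta})_{1\le\alpha,\beta\le n+1}$ be the product metric on $V\times R$, and note $\partial(V\times R)=V\times\partial R$. A function $\psi$ on $V\times R$ is called generalized plurisubharmonic if it is continuous on $V\times R$, of class $C^2$ in the interior, and the Hermitian matrix $\big(g_{\alpha\bar\beta}+\frac{\partial^2\psi}{\partial z_\alpha\partial\bar z_\beta}\big)_{1\le\alpha,\beta\le n+1}$ is positive definite there. Let $h:\partial(V\times R)\to\mathbb R$. A continuous function $\varphi:V\times R\to\mathbb R$ is called a weak $C^0$ solution of the degenerate Monge–Ampère equation $$\det\Big(g_{\alpha\bar\beta}+\frac{\partial^2\varphi}{\partial z_\alpha\partial\bar z_\beta}\Big)_{(n+1)\times(n+1)}=0\ \text{ in } V\times R$$ with boundary data $h$ if for every $\varepsilon>0$ there are a generalized plurisubharmonic function $\psi$ on $V\times R$ and a function $f$ with $0<f<\varepsilon$ such that $|\varphi-\psi|<\varepsilon$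 on $V\times R$, $\det\big(g_{\alpha\bar\beta}+\frac{\partial^2\psi}{\partial z_\alpha\partial\bar z_\beta}\big)=f\det(g_{\alpha\bar\beta})$ in the interior of $V\times R$, and $\psi=h$ on $\partial(V\times R)$. **Theorem.** If $\varphi_1,\varphi_2$ are weak $C^0$ solutions of the degenerate Monge–Ampère equation with boundary data $h_1,h_2$ respectively, then the following maxima exist and $$\max_{V\times R}|\varphi_1-\varphi_2|\le\max_{\partial(V\times R)}|h_1-h_2|.$$ **Corollary.** Two weak $C^0$ solutions of the degenerate Monge–Ampère equation with the same boundary data coincide. -/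

import Mathlib

open Set
open scoped Manifold ContDiff ComplexConjugate ComplexOrder

noncomputable section

/-! ### Complex manifolds with boundary of complex dimension one -/

/-- The closed upper half plane, on which Riemann surfaces with boundary are modelled. -/
abbrev ClosedHalfPlane : Type := {z : ℂ // 0 ≤ z.im}

theorem range_val_closedHalfPlane :
    range (Subtype.val : ClosedHalfPlane → ℂ) = {z : ℂ | 0 ≤ z.im} :=
  Subtype.range_coe

/-- The closed upper half plane as a model with corners over `ℂ`. A space which is an
`IsManifold halfPlaneModel ∞` is a Riemann surface with (possibly empty) boundary: the transition
maps are holomorphic, and smooth up to the boundary. -/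
def halfPlaneModel : ModelWithCorners ℂ ℂ ClosedHalfPlane where
  toFun := Subtype.val
  invFun z := ⟨⟨z.re, max z.im 0⟩, le_max_right _ _⟩
  source := univ
  target := {z | 0 ≤ z.im}
  map_source' z _ := z.property
  map_target' _ _ := mem_univ _
  left_inv' := fun ⟨z, hz⟩ _ => Subtype.ext (Complex.ext rfl (max_eq_left hz))
  right_inv' _ hz := Complex.ext rfl (max_eq_left hz)
  source_eq := rfl
  convex_range' := by
    simp only [instIsRCLikeNormedField, ↓reduceDIte]
    apply Convex.convex_isRCLikeNormedField
    rw [range_val_closedHalfPlane]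
    exact convex_halfSpace_im_ge 0
  nonempty_interior' := by
    rw [range_val_closedHalfPlane, Complex.interior_setOfPred_le_im]
    exact ⟨Complex.I, by simp⟩
  continuous_toFun := continuous_subtype_val
  continuous_invFun := by
    refine Continuous.subtype_mk ?_ _
    have h : Continuous fun z : ℂ => ((z.re : ℂ) + (max z.im 0 : ℝ) * Complex.I) := by fun_prop
    exact h.congr fun z => by simp [Complex.ext_iff]

section Wirtinger

variable {E : Type*} [NormedAddCommGroup E] [NormedSpace ℂ E]

/-- The Wirtinger derivative `∂F` at `y`, applied to `v`: for `E = ℂᵐ` and `v = e_α` this is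
`∂F/∂z_α = (∂F/∂x_α - i ∂F/∂y_α) / 2`. -/
def dZ (F : E → ℂ) (y v : E) : ℂ :=
  (fderiv ℝ F y v - Complex.I * fderiv ℝ F y (Complex.I • v)) / 2

/-- The Wirtinger derivative `∂̄F` at `y`, applied to `v`: for `E = ℂᵐ` and `v = e_α` this is
`∂F/∂z̄_α = (∂F/∂x_α + i ∂F/∂y_α) / 2`. -/
def dZbar (F : E → ℂ) (y v : E) : ℂ :=
  (fderiv ℝ F y v + Complex.I * fderiv ℝ F y (Complex.I • v)) / 2

/-- The complex Hessian of a real function: for `E = ℂᵐ`, `v = e_α`, `w = e_β` this is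
`∂²u/∂z_α ∂z̄_β`. -/
def complexHessian (u : E → ℝ) (y v w : E) : ℂ :=
  dZ (fun y' => dZbar (fun y'' => (u y'' : ℂ)) y' w) y v

end Wirtinger

section Metric

variable {E : Type*} [NormedAddCommGroup E] [NormedSpace ℂ E]
  {H : Type*} [TopologicalSpace H] (I : ModelWithCorners ℂ E H)
  (M : Type*) [TopologicalSpace M] [ChartedSpace H M]

variable {M} in
/-- The coefficient `g(v, w̄)` of a family of sesquilinear forms on the (holomorphic) tangent
spaces, read in the chart around `c`, as a function of the coordinate `y`. -/
def metricCoeff (g : ∀ x : M, TangentSpace I x →L[ℂ] TangentSpace I x →L⋆[ℂ] ℂ)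
    (c : M) (v w y : E) : ℂ :=
  g ((extChartAt I c).symm y)
    (mfderivWithin 𝓘(ℂ, E) I (extChartAt I c).symm (range I) y v)
    (mfderivWithin 𝓘(ℂ, E) I (extChartAt I c).symm (range I) y w)

/-- A Kähler metric `∑ g_{αβ̄} dz_α dz̄_β`: a smooth positive definite Hermitian form on the tangent
spaces whose Kähler form is closed, i.e. `∂g_{αβ̄}/∂z_γ = ∂g_{γβ̄}/∂z_α` in the charts. (At boundary
points closedness follows from the interior by continuity.) -/
structure KahlerMetric where
  /-- The Hermitian form, linear in the first and conjugate linear in the second variable. -/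
  form : ∀ x : M, TangentSpace I x →L[ℂ] TangentSpace I x →L⋆[ℂ] ℂ
  conj_symm : ∀ (x : M) (v w : TangentSpace I x), conj (form x v w) = form x w v
  pos : ∀ (x : M) (v : TangentSpace I x), v ≠ 0 → 0 < (form x v v).re
  smooth : ∀ (c : M) (v w : E),
    ContDiffOn ℝ ∞ (metricCoeff I form c v w) (extChartAt I c).target
  closed : ∀ (c : M) (u v w : E), ∀ y ∈ interior (extChartAt I c).target,
    dZ (metricCoeff I form c v w) y u = dZ (metricCoeff I form c u w) y v

end Metric

section Product

/-- The model of the product of an `n`-dimensional complex manifold (without boundary) and a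
Riemann surface with boundary. -/
abbrev productModel (n : ℕ) :
    ModelWithCorners ℂ (EuclideanSpace ℂ (Fin n) × ℂ)
      (ModelProd (EuclideanSpace ℂ (Fin n)) ClosedHalfPlane) :=
  𝓘(ℂ, EuclideanSpace ℂ (Fin n)).prod halfPlaneModel

/-- The coordinate vectors `e_1, …, e_n, e_{n+1}` of `ℂⁿ × ℂ`; the last one is `Sum.inr ()`. -/
def coordVec (n : ℕ) : Fin n ⊕ Unit → EuclideanSpace ℂ (Fin n) × ℂ
  | Sum.inl i => (EuclideanSpace.single i 1, 0)
  | Sum.inr _ => (0, 1)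

variable {n : ℕ}
  {V : Type*} [TopologicalSpace V] [ChartedSpace (EuclideanSpace ℂ (Fin n)) V]
  {R : Type*} [TopologicalSpace R] [ChartedSpace ClosedHalfPlane R]
  (gV : KahlerMetric 𝓘(ℂ, EuclideanSpace ℂ (Fin n)) V) (gR : KahlerMetric halfPlaneModel R)

/-- The matrix `(g_{αβ̄})` of size `n + 1` of the product metric at `p`, in the coordinates given by
the preferred chart at `p` (the tangent space at `p` is `ℂⁿ × ℂ` through that chart). -/
def metricMatrix (p : V × R) : Matrix (Fin n ⊕ Unit) (Fin n ⊕ Unit) ℂ :=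
  Matrix.of fun a b =>
    gV.form p.1 (coordVec n a).1 (coordVec n b).1 + gR.form p.2 (coordVec n a).2 (coordVec n b).2

/-- The matrix `(∂²φ/∂z_α ∂z̄_β)` of size `n + 1` at `p`, in the coordinates given by the preferred
chart at `p`. -/
def hessianMatrix (φ : V × R → ℝ) (p : V × R) : Matrix (Fin n ⊕ Unit) (Fin n ⊕ Unit) ℂ :=
  Matrix.of fun a b =>
    complexHessian (φ ∘ (extChartAt (productModel n) p).symm) (extChartAt (productModel n) p p)
      (coordVec n a) (coordVec n b)

/-- Generalized plurisubharmonic functions: continuous on `V × R`, of class `C²` in its interior,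
with `(g_{αβ̄} + ∂²φ/∂z_α ∂z̄_β)` Hermitian and strictly positive there. -/
structure IsGeneralizedPSH (φ : V × R → ℝ) : Prop where
  continuous : Continuous φ
  contDiffAt : ∀ p ∈ (productModel n).interior (V × R),
    ContDiffAt ℝ 2 (φ ∘ (extChartAt (productModel n) p).symm) (extChartAt (productModel n) p p)
  posDef : ∀ p ∈ (productModel n).interior (V × R),
    (metricMatrix gV gR p + hessianMatrix φ p).PosDef

/-- `φ` solves the Dirichlet problem `det (g_{αβ̄} + ∂²φ/∂z_α ∂z̄_β) = f det (g_{αβ̄})` in `V × R`,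
`φ = h` on `∂(V × R)`. -/
def SolvesMongeAmpere (f : V × R → ℝ) (h : (productModel n).boundary (V × R) → ℝ)
    (φ : V × R → ℝ) : Prop :=
  (∀ p ∈ (productModel n).interior (V × R),
    (metricMatrix gV gR p + hessianMatrix φ p).det = (f p : ℂ) * (metricMatrix gV gR p).det) ∧
  ∀ q : (productModel n).boundary (V × R), φ q = h q

/-- Weak `C⁰` solutions, with boundary data `h`, of the degenerate Monge-Ampère equation
`det (g_{αβ̄} + ∂²φ/∂z_α ∂z̄_β) = 0`. -/
def IsWeakC0Solution (h : (productModel n).boundary (V × R) → ℝ) (φ : V × R → ℝ) : Prop :=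
  Continuous φ ∧
  ∀ ε : ℝ, 0 < ε → ∃ (ψ f : V × R → ℝ),
    IsGeneralizedPSH gV gR ψ ∧
    (∀ p, |φ p - ψ p| < ε) ∧
    (∀ p ∈ (productModel n).interior (V × R), 0 < f p ∧ f p < ε) ∧
    SolvesMongeAmpere gV gR f h ψ

end Product

end

/-!
At an interior maximum of `c ψ₁ - ψ₂`, where `0 ≤ c < 1`, the complex Hessian of `c ψ₁ - ψ₂` is
negative semidefinite, so `g + ∂∂̄ψ₂ ≥ (1 - c) g + c (g + ∂∂̄ψ₁) ≥ (1 - c) g` and hence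
`det (g + ∂∂̄ψ₂) ≥ (1 - c) ^ m det g`, where `m` is the dimension. If `ψ₂` approximates a weak
solution so well that `det (g + ∂∂̄ψ₂) < (1 - c) ^ m det g`, the maximum therefore lies on the
boundary. Letting first the approximations converge and then `c` tend to `1` compares the weak
solutions themselves.
-/

noncomputable section

section Determinant

variable {𝕜 ι : Type*} [RCLike 𝕜] [Fintype ι] [DecidableEq ι]

open Matrix
open scoped MatrixOrder

theorem one_le_det_of_one_le {A : Matrix ι ι 𝕜} (hA : 1 ≤ A) : 1 ≤ A.det := by
  have hA' : A.IsHermitian := (zero_le_one.trans hA).posSemidef.isHermitian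
  have hspec : ∀ x ∈ spectrum ℝ A, 1 ≤ x :=
    (algebraMap_le_iff_le_spectrum hA'.isSelfAdjoint).1 (by rwa [map_one])
  have hprod : 1 ≤ ∏ i, hA'.eigenvalues i :=
    Finset.prod_induction _ (1 ≤ ·) (fun _ _ => one_le_mul_of_one_le_of_one_le) le_rfl
      fun i _ => hspec _ (hA'.eigenvalues_mem_spectrum_real i)
  rw [hA'.det_eq_prod_eigenvalues]
  exact_mod_cast hprod

theorem det_le_det_of_posDef_of_le {P Q : Matrix ι ι 𝕜} (hP : P.PosDef) (hPQ : P ≤ Q) :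
    P.det ≤ Q.det := by
  obtain ⟨B, rfl⟩ := CStarAlgebra.nonneg_iff_eq_star_mul_self.1 hP.posSemidef.nonneg
  have hB : IsUnit B.det := by
    have hdet := hP.det_pos.ne'
    rw [det_mul] at hdet
    exact isUnit_iff_ne_zero.2 (right_ne_zero_of_mul hdet)
  have hone : star B⁻¹ * (star B * B) * B⁻¹ = 1 := by
    rw [← mul_assoc, ← star_mul, mul_assoc, mul_nonsing_inv B hB, star_one, mul_one]
  have hle : 1 ≤ star B⁻¹ * Q * B⁻¹ := hone ▸ star_left_conjugate_le_conjugate hPQ B⁻¹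
  have hQ : Q = star B * (star B⁻¹ * Q * B⁻¹) * B := by
    calc Q = star (B⁻¹ * B) * Q * (B⁻¹ * B) := by simp [nonsing_inv_mul B hB]
      _ = star B * (star B⁻¹ * Q * B⁻¹) * B := by simp only [star_mul, mul_assoc]
  calc (star B * B).det ≤ (star B * B).det * (star B⁻¹ * Q * B⁻¹).det :=
        le_mul_of_one_le_right hP.det_pos.le (one_le_det_of_one_le hle)
    _ = (star B * (star B⁻¹ * Q * B⁻¹) * B).det := by simp only [det_mul]; ring
    _ = Q.det := by rw [← hQ]

end Determinant

section GramMatrix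

variable {𝕜 ι E : Type*} [RCLike 𝕜] [AddCommGroup E] [Module 𝕜 E]

open Matrix

theorem star_dotProduct_of_mulVec [Fintype ι] (Q : E →ₗ[𝕜] E →ₗ⋆[𝕜] 𝕜) (e : ι → E) (x : ι → 𝕜) :
    star x ⬝ᵥ (of fun a b => Q (e a) (e b)) *ᵥ x =
      Q (∑ a, conj (x a) • e a) (∑ a, conj (x a) • e a) := by
  simp only [map_sum, LinearMap.sum_apply, map_smul, LinearMap.smul_apply, map_smulₛₗ,
    dotProduct, mulVec, Pi.star_apply, of_apply, smul_eq_mul, RCLike.conj_conj, Finset.mul_sum,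
    RCLike.star_def]
  rw [Finset.sum_comm]
  exact Finset.sum_congr rfl fun a _ => Finset.sum_congr rfl fun b _ => by ring

variable [Finite ι] {Q : E →ₗ[𝕜] E →ₗ⋆[𝕜] 𝕜}

theorem posSemidef_of_sesquilinear (hQ : ∀ v w, conj (Q v w) = Q w v) (hpos : ∀ v, 0 ≤ Q v v)
    (e : ι → E) : (of fun a b => Q (e a) (e b)).PosSemidef := by
  cases nonempty_fintype ι
  refine .of_dotProduct_mulVec_nonneg (.ext fun a b => hQ _ _) fun x => ?_
  rw [star_dotProduct_of_mulVec]
  exact hpos _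

theorem posDef_of_sesquilinear (hQ : ∀ v w, conj (Q v w) = Q w v)
    (hpos : ∀ v, v ≠ 0 → 0 < Q v v) {e : ι → E} (he : LinearIndependent 𝕜 e) :
    (of fun a b => Q (e a) (e b)).PosDef := by
  cases nonempty_fintype ι
  refine .of_dotProduct_mulVec_pos (.ext fun a b => hQ _ _) fun x hx => ?_
  rw [star_dotProduct_of_mulVec]
  refine hpos _ fun hsum => hx (funext fun a => ?_)
  simpa using Fintype.linearIndependent_iff.1 he _ hsum a

end GramMatrix

section SecondDerivative

open Topology

theorem deriv_deriv_nonpos_of_isLocalMax {f : ℝ → ℝ} {x : ℝ} (hmax : IsLocalMax f x)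
    (hf : ContinuousAt f x) : deriv (deriv f) x ≤ 0 := by
  by_contra! hpos
  have hmin : IsLocalMin f x := isLocalMin_of_deriv_deriv_pos hpos hmax.deriv_eq_zero hf
  have hconst : f =ᶠ[𝓝 x] fun _ => f x := by
    filter_upwards [hmin, hmax] with t h₁ h₂ using le_antisymm h₂ h₁
  have hzero := hconst.deriv.deriv_eq
  simp only [deriv_const', deriv_const] at hzero
  exact hpos.ne' hzero

variable {F : Type*} [NormedAddCommGroup F] [NormedSpace ℝ F] {u u₁ u₂ : F → ℝ} {y : F}

theorem eventually_differentiableAt_of_contDiffAt_two (hu : ContDiffAt ℝ 2 u y) :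
    ∀ᶠ z in 𝓝 y, DifferentiableAt ℝ u z :=
  (hu.eventually (by simp)).mono fun _ hz => hz.differentiableAt two_ne_zero

theorem differentiableAt_fderiv_of_contDiffAt_two (hu : ContDiffAt ℝ 2 u y) :
    DifferentiableAt ℝ (fderiv ℝ u) y :=
  (hu.fderiv_right (m := 1) (by norm_num)).differentiableAt one_ne_zero

theorem deriv_deriv_add_smul (hu : ContDiffAt ℝ 2 u y) (v : F) :
    deriv (deriv fun t : ℝ => u (y + t • v)) 0 = fderiv ℝ (fderiv ℝ u) y v v := by
  have hline (t : ℝ) : HasDerivAt (fun t : ℝ => y + t • v) v t := by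
    simpa using ((hasDerivAt_id t).smul_const v).const_add y
  have hy : y + (0 : ℝ) • v = y := by simp
  have hlim : Filter.Tendsto (fun t : ℝ => y + t • v) (𝓝 0) (𝓝 y) := by
    simpa using (hline 0).continuousAt.tendsto
  have hderiv : deriv (fun t : ℝ => u (y + t • v)) =ᶠ[𝓝 0] fun t => fderiv ℝ u (y + t • v) v := by
    filter_upwards [hlim.eventually (eventually_differentiableAt_of_contDiffAt_two hu)] with t ht
    exact (ht.hasFDerivAt.comp_hasDerivAt t (hline t)).deriv
  have hD : HasFDerivAt (fderiv ℝ u) (fderiv ℝ (fderiv ℝ u) y) (y + (0 : ℝ) • v) :=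
    hy.symm ▸ (differentiableAt_fderiv_of_contDiffAt_two hu).hasFDerivAt
  rw [hderiv.deriv_eq]
  exact ((ContinuousLinearMap.apply ℝ ℝ v).hasFDerivAt.comp_hasDerivAt (0 : ℝ)
    (hD.comp_hasDerivAt (0 : ℝ) (hline 0))).deriv

theorem fderiv_fderiv_apply_self_nonpos_of_isLocalMax (hmax : IsLocalMax u y)
    (hu : ContDiffAt ℝ 2 u y) (v : F) : fderiv ℝ (fderiv ℝ u) y v v ≤ 0 := by
  have hline : ContinuousAt (fun t : ℝ => y + t • v) 0 := by fun_prop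
  have hy : y + (0 : ℝ) • v = y := by simp
  rw [← deriv_deriv_add_smul hu]
  refine deriv_deriv_nonpos_of_isLocalMax ?_ ?_
  · exact IsLocalMax.comp_continuous (g := fun t : ℝ => y + t • v) (by rwa [hy]) hline
  · exact ContinuousAt.comp (f := fun t : ℝ => y + t • v) (by rw [hy]; exact hu.continuousAt) hline

theorem fderiv_fderiv_const_mul_sub (hu₁ : ContDiffAt ℝ 2 u₁ y) (hu₂ : ContDiffAt ℝ 2 u₂ y)
    (c : ℝ) : fderiv ℝ (fderiv ℝ fun z => c * u₁ z - u₂ z) y =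
      c • fderiv ℝ (fderiv ℝ u₁) y - fderiv ℝ (fderiv ℝ u₂) y := by
  have hfirst : fderiv ℝ (fun z => c * u₁ z - u₂ z) =ᶠ[𝓝 y]
      fun z => c • fderiv ℝ u₁ z - fderiv ℝ u₂ z := by
    filter_upwards [eventually_differentiableAt_of_contDiffAt_two hu₁,
      eventually_differentiableAt_of_contDiffAt_two hu₂] with z hz₁ hz₂
    exact ((hz₁.hasFDerivAt.const_mul c).sub hz₂.hasFDerivAt).fderiv
  have hD₁ := (differentiableAt_fderiv_of_contDiffAt_two hu₁).hasFDerivAt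
  have hD₂ := (differentiableAt_fderiv_of_contDiffAt_two hu₂).hasFDerivAt
  exact hfirst.fderiv_eq.trans ((hD₁.const_smul c).sub hD₂).fderiv

end SecondDerivative

section LeviForm

variable {E : Type*} [AddCommGroup E] [Module ℂ E]

theorem complex_smul_eq_re_smul_add_im_smul (c : ℂ) (v : E) :
    c • v = c.re • v + c.im • Complex.I • v := by
  conv_lhs => rw [← Complex.re_add_im c, add_smul, mul_smul]
  simp only [Complex.coe_smul]

/-- The Levi form of a real bilinear form `B` on a complex vector space: a quarter of the
sesquilinear form whose real part is `B(v, w) + B(iv, iw)`. The Levi form of the second derivative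
of `u` is the complex Hessian of `u`. -/
def leviForm (B : E →ₗ[ℝ] E →ₗ[ℝ] ℝ) : E →ₗ[ℂ] E →ₗ⋆[ℂ] ℂ :=
  have hI (v : E) : Complex.I • Complex.I • v = -v := by
    rw [smul_smul, Complex.I_mul_I, neg_one_smul]
  have hIr (r : ℝ) (v : E) : Complex.I • r • v = r • Complex.I • v := smul_comm _ _ _
  LinearMap.mk₂'ₛₗ (RingHom.id ℂ) (starRingEnd ℂ)
    (fun v w => ((B v w + B (Complex.I • v) (Complex.I • w) : ℝ) +
      Complex.I * (B v (Complex.I • w) - B (Complex.I • v) w : ℝ)) / 4)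
    (fun v v' w => by
      simp only [smul_add, map_add, LinearMap.add_apply]
      push_cast
      ring)
    (fun c v w => by
      rw [complex_smul_eq_re_smul_add_im_smul c v]
      simp only [smul_add, map_add, map_smul, LinearMap.add_apply, LinearMap.smul_apply, hIr, hI,
        map_neg, LinearMap.neg_apply]
      apply Complex.ext <;> simp <;> ring)
    (fun v w w' => by
      simp only [smul_add, map_add]
      push_cast
      ring)
    (fun c v w => by
      rw [complex_smul_eq_re_smul_add_im_smul c w]
      simp only [smul_add, map_add, map_smul, hIr, hI, map_neg]
      apply Complex.ext <;> simp <;> ring)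

theorem leviForm_apply (B : E →ₗ[ℝ] E →ₗ[ℝ] ℝ) (v w : E) :
    leviForm B v w = ((B v w + B (Complex.I • v) (Complex.I • w) : ℝ) +
      Complex.I * (B v (Complex.I • w) - B (Complex.I • v) w : ℝ)) / 4 := rfl

theorem conj_leviForm {B : E →ₗ[ℝ] E →ₗ[ℝ] ℝ} (hB : ∀ v w, B v w = B w v) (v w : E) :
    conj (leviForm B v w) = leviForm B w v := by
  rw [leviForm_apply, leviForm_apply, hB w v, hB (Complex.I • w) (Complex.I • v),
    hB w (Complex.I • v), hB (Complex.I • w) v, map_div₀, map_add, map_mul, Complex.conj_ofReal,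
    Complex.conj_ofReal, Complex.conj_I, map_ofNat]
  push_cast
  ring

theorem leviForm_self {B : E →ₗ[ℝ] E →ₗ[ℝ] ℝ} (hB : ∀ v w, B v w = B w v) (v : E) :
    leviForm B v v = ((B v v + B (Complex.I • v) (Complex.I • v)) / 4 : ℝ) := by
  rw [leviForm_apply, hB v (Complex.I • v)]
  simp

end LeviForm

section ComplexHessian

open Topology
open scoped MatrixOrder

variable {ι κ E : Type*} [NormedAddCommGroup E] [NormedSpace ℂ E] {u u₁ u₂ : E → ℝ} {y : E}

theorem complexHessian_eq_leviForm (hu : ContDiffAt ℝ 2 u y) (v w : E) :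
    complexHessian u y v w = leviForm (fderiv ℝ (fderiv ℝ u) y).toLinearMap₁₂ v w := by
  have hdZbar : (fun z => dZbar (fun z' => (u z' : ℂ)) z w) =ᶠ[𝓝 y] fun z =>
      ((fderiv ℝ u z w : ℂ) + Complex.I * (fderiv ℝ u z (Complex.I • w) : ℝ)) * (1 / 2) := by
    filter_upwards [eventually_differentiableAt_of_contDiffAt_two hu] with z hz
    have hcast := Complex.ofRealCLM.hasFDerivAt.comp z hz.hasFDerivAt
    rw [dZbar, show fderiv ℝ (fun z' => (u z' : ℂ)) z = _ from hcast.fderiv]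
    simp only [ContinuousLinearMap.comp_apply, Complex.ofRealCLM_apply]
    ring
  have hcoeff (a : E) : HasFDerivAt (fun z => ((fderiv ℝ u z a : ℝ) : ℂ))
      (Complex.ofRealCLM.comp ((fderiv ℝ (fderiv ℝ u) y).flip a)) y :=
    Complex.ofRealCLM.hasFDerivAt.comp y <| by
      simpa using (differentiableAt_fderiv_of_contDiffAt_two hu).hasFDerivAt.clm_apply
        (hasFDerivAt_const a y)
  have hderiv := hdZbar.fderiv_eq.trans
    (((hcoeff w).add ((hcoeff (Complex.I • w)).const_mul Complex.I)).mul_const (1 / 2 : ℂ)).fderiv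
  rw [complexHessian, dZ, hderiv, leviForm_apply]
  simp only [smul_add, add_apply, smul_apply, ContinuousLinearMap.comp_apply,
    ContinuousLinearMap.flip_apply, Complex.ofRealCLM_apply, smul_eq_mul,
    ContinuousLinearMap.toLinearMap₁₂_apply_apply_apply, Complex.ofReal_add, Complex.ofReal_sub]
  linear_combination
    (-(fderiv ℝ (fderiv ℝ u) y (Complex.I • v) (Complex.I • w) : ℂ) / 4) * Complex.I_sq

/-- The matrix `(∂²u/∂z_a ∂z̄_b)` of the complex Hessian of `u` at `y`, for a family `e` of vectors
in place of the coordinate vectors. -/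
def complexHessianMatrix (e : ι → E) (u : E → ℝ) (y : E) : Matrix ι ι ℂ :=
  Matrix.of fun a b => complexHessian u y (e a) (e b)

theorem complexHessianMatrix_const_mul_sub (hu₁ : ContDiffAt ℝ 2 u₁ y) (hu₂ : ContDiffAt ℝ 2 u₂ y)
    (e : ι → E) (c : ℝ) :
    complexHessianMatrix e (fun z => c * u₁ z - u₂ z) y =
      (c : ℂ) • complexHessianMatrix e u₁ y - complexHessianMatrix e u₂ y := by
  have hu : ContDiffAt ℝ 2 (fun z => c * u₁ z - u₂ z) y := (contDiffAt_const.mul hu₁).sub hu₂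
  ext a b
  simp only [complexHessianMatrix, Matrix.sub_apply, Matrix.smul_apply, Matrix.of_apply,
    complexHessian_eq_leviForm hu, complexHessian_eq_leviForm hu₁, complexHessian_eq_leviForm hu₂,
    fderiv_fderiv_const_mul_sub hu₁ hu₂, leviForm_apply, map_sub, map_smul, LinearMap.sub_apply,
    LinearMap.smul_apply, ContinuousLinearMap.toLinearMap₁₂_apply_apply_apply, smul_eq_mul]
  push_cast
  ring

variable [Finite ι]

theorem posSemidef_neg_complexHessianMatrix_of_isLocalMax (hmax : IsLocalMax u y)
    (hu : ContDiffAt ℝ 2 u y) (e : ι → E) : (-complexHessianMatrix e u y).PosSemidef := by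
  set B := (fderiv ℝ (fderiv ℝ u) y).toLinearMap₁₂
  have hB : ∀ v w, B v w = B w v := (hu.isSymmSndFDerivAt (by simp)).eq
  have hneg : -complexHessianMatrix e u y = Matrix.of fun a b => (-leviForm B) (e a) (e b) := by
    ext a b
    exact congrArg Neg.neg (complexHessian_eq_leviForm hu _ _)
  rw [hneg]
  refine posSemidef_of_sesquilinear (fun v w => ?_) (fun v => ?_) e
  · exact (map_neg _ _).trans (congrArg _ (conj_leviForm hB v w))
  · have h₁ : B v v ≤ 0 := fderiv_fderiv_apply_self_nonpos_of_isLocalMax hmax hu v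
    have h₂ : B (Complex.I • v) (Complex.I • v) ≤ 0 :=
      fderiv_fderiv_apply_self_nonpos_of_isLocalMax hmax hu _
    rw [LinearMap.neg_apply, LinearMap.neg_apply, leviForm_self hB]
    exact_mod_cast (by linarith : 0 ≤ -((B v v + B (Complex.I • v) (Complex.I • v)) / 4))

theorem smul_le_add_complexHessianMatrix_of_isLocalMax {G : Matrix ι ι ℂ} {e : ι → E} {c : ℝ}
    (hc : 0 ≤ c) (hu₁ : ContDiffAt ℝ 2 u₁ y) (hu₂ : ContDiffAt ℝ 2 u₂ y)
    (hmax : IsLocalMax (fun z => c * u₁ z - u₂ z) y)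
    (hG : (G + complexHessianMatrix e u₁ y).PosSemidef) :
    ((1 - c : ℝ) : ℂ) • G ≤ G + complexHessianMatrix e u₂ y := by
  have hneg := posSemidef_neg_complexHessianMatrix_of_isLocalMax hmax
    ((contDiffAt_const.mul hu₁).sub hu₂) e
  rw [complexHessianMatrix_const_mul_sub hu₁ hu₂] at hneg
  rw [Matrix.le_iff]
  have hdiff : G + complexHessianMatrix e u₂ y - ((1 - c : ℝ) : ℂ) • G =
      (c : ℂ) • (G + complexHessianMatrix e u₁ y) +
        -((c : ℂ) • complexHessianMatrix e u₁ y - complexHessianMatrix e u₂ y) := by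
    rw [Complex.ofReal_sub, Complex.ofReal_one, sub_smul, one_smul, smul_add]
    abel
  exact hdiff ▸ (hG.smul (Complex.zero_le_real.2 hc)).add hneg

theorem pow_mul_det_le_det_add_complexHessianMatrix_of_isLocalMax [Fintype κ] [DecidableEq κ]
    {G : Matrix κ κ ℂ} {e : κ → E} {c : ℝ} (hc : 0 ≤ c) (hc' : c < 1)
    (hu₁ : ContDiffAt ℝ 2 u₁ y) (hu₂ : ContDiffAt ℝ 2 u₂ y)
    (hmax : IsLocalMax (fun z => c * u₁ z - u₂ z) y) (hG : G.PosDef)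
    (hG₁ : (G + complexHessianMatrix e u₁ y).PosSemidef) :
    ((1 - c : ℝ) : ℂ) ^ Fintype.card κ * G.det ≤ (G + complexHessianMatrix e u₂ y).det := by
  rw [← Matrix.det_smul]
  exact det_le_det_of_posDef_of_le (hG.smul (Complex.zero_lt_real.2 (sub_pos.2 hc')))
    (smul_le_add_complexHessianMatrix_of_isLocalMax hc hu₁ hu₂ hmax hG₁)

end ComplexHessian

section WeakSolution

open Topology

variable {E H M ι : Type*} [NormedAddCommGroup E] [NormedSpace ℂ E] [TopologicalSpace H]
  (I : ModelWithCorners ℂ E H) [TopologicalSpace M] [ChartedSpace H M] (e : ι → E)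

/-- The complex Hessian matrix at `p` of a function on a complex manifold, in the coordinates given
by the preferred chart at `p`, for a family `e` of vectors in place of the coordinate vectors. -/
def chartHessianMatrix (φ : M → ℝ) (p : M) : Matrix ι ι ℂ :=
  complexHessianMatrix e (φ ∘ (extChartAt I p).symm) (extChartAt I p p)

/-- Functions strictly plurisubharmonic relative to a Hermitian form `g`. The form is encoded by its
coefficient matrices: `g p` is its matrix at `p` in the coordinates given by the preferred chart at
`p`. -/
structure IsStrictlyPSH (g : M → Matrix ι ι ℂ) (ψ : M → ℝ) : Prop where
  continuous : Continuous ψ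
  contDiffAt : ∀ p ∈ I.interior M, ContDiffAt ℝ 2 (ψ ∘ (extChartAt I p).symm) (extChartAt I p p)
  posDef : ∀ p ∈ I.interior M, (g p + chartHessianMatrix I e ψ p).PosDef

variable [Fintype ι] [DecidableEq ι]

/-- Weak `C⁰` solutions, with boundary data `h`, of the degenerate Monge-Ampère equation
`det (g + ∂∂̄φ) = 0`, for a Hermitian form `g` encoded as in `IsStrictlyPSH`. -/
def IsWeakMongeAmpereSolution (g : M → Matrix ι ι ℂ) (h : I.boundary M → ℝ) (φ : M → ℝ) : Prop :=
  Continuous φ ∧ ∀ ε : ℝ, 0 < ε → ∃ ψ f : M → ℝ,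
    IsStrictlyPSH I e g ψ ∧ (∀ p, |φ p - ψ p| < ε) ∧
    (∀ p ∈ I.interior M, 0 < f p ∧ f p < ε) ∧
    (∀ p ∈ I.interior M,
      (g p + chartHessianMatrix I e ψ p).det = (f p : ℂ) * (g p).det) ∧
    ∀ q : I.boundary M, ψ q = h q

variable {I e} {g : M → Matrix ι ι ℂ} {h h₁ h₂ : I.boundary M → ℝ} {φ φ₁ φ₂ ψ₁ ψ₂ : M → ℝ}

theorem isLocalMax_comp_extChartAt_symm {u : M → ℝ} {p : M} (hp : ∀ x, u x ≤ u p) :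
    IsLocalMax (u ∘ (extChartAt I p).symm) (extChartAt I p p) :=
  .of_forall fun z => by simpa using hp ((extChartAt I p).symm z)

theorem IsStrictlyPSH.exists_mem_boundary_forall_mul_sub_le [CompactSpace M] [Nonempty M]
    (hg : ∀ p ∈ I.interior M, (g p).PosDef) (hψ₁ : IsStrictlyPSH I e g ψ₁)
    (hψ₂ : IsStrictlyPSH I e g ψ₂) {c : ℝ} (hc : 0 ≤ c) (hc' : c < 1)
    (hdet : ∀ p ∈ I.interior M, (g p + chartHessianMatrix I e ψ₂ p).det <
      ((1 - c : ℝ) : ℂ) ^ Fintype.card ι * (g p).det) :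
    ∃ q ∈ I.boundary M, ∀ x, c * ψ₁ x - ψ₂ x ≤ c * ψ₁ q - ψ₂ q := by
  obtain ⟨q, -, hq⟩ := isCompact_univ.exists_isMaxOn univ_nonempty
    ((hψ₁.continuous.const_mul c).sub hψ₂.continuous).continuousOn
  have hmax : ∀ x, c * ψ₁ x - ψ₂ x ≤ c * ψ₁ q - ψ₂ q := fun x => hq (mem_univ x)
  refine ⟨q, ?_, hmax⟩
  rw [← I.compl_interior]
  intro hint
  exact (hdet q hint).not_ge <| pow_mul_det_le_det_add_complexHessianMatrix_of_isLocalMax hc hc'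
    (hψ₁.contDiffAt q hint) (hψ₂.contDiffAt q hint) (isLocalMax_comp_extChartAt_symm hmax)
    (hg q hint) (hψ₁.posDef q hint).posSemidef

namespace IsWeakMongeAmpereSolution

theorem continuous (hφ : IsWeakMongeAmpereSolution I e g h φ) : Continuous φ := hφ.1

theorem eq_boundaryData (hφ : IsWeakMongeAmpereSolution I e g h φ) (q : I.boundary M) :
    φ q = h q := by
  refine eq_of_abs_sub_eq_zero (le_antisymm (le_of_forall_pos_le_add fun ε hε => ?_) (abs_nonneg _))
  obtain ⟨ψ, -, -, hclose, -, -, hψ⟩ := hφ.2 ε hε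
  rw [← hψ q, zero_add]
  exact (hclose q).le

variable [CompactSpace M] [Nonempty M]

theorem exists_mem_boundary_forall_mul_sub_le (hg : ∀ p ∈ I.interior M, (g p).PosDef)
    (hφ₁ : IsWeakMongeAmpereSolution I e g h₁ φ₁) (hφ₂ : IsWeakMongeAmpereSolution I e g h₂ φ₂)
    {c η : ℝ} (hc : 0 ≤ c) (hc' : c < 1) (hη : 0 < η) :
    ∃ q : I.boundary M, ∀ x, c * φ₁ x - φ₂ x ≤ c * h₁ q - h₂ q + η := by
  have hpow : 0 < (1 - c) ^ Fintype.card ι := pow_pos (sub_pos.2 hc') _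
  obtain ⟨ψ₁, -, hψ₁, hclose₁, -, -, hbdry₁⟩ := hφ₁.2 (η / 2) (half_pos hη)
  obtain ⟨ψ₂, f, hψ₂, hclose₂, hf, hdet, hbdry₂⟩ :=
    hφ₂.2 (min (η / 2) ((1 - c) ^ Fintype.card ι)) (lt_min (half_pos hη) hpow)
  obtain ⟨q, hq, hmax⟩ := hψ₁.exists_mem_boundary_forall_mul_sub_le hg hψ₂ hc hc' fun p hp => by
    rw [hdet p hp, ← Complex.ofReal_pow]
    exact mul_lt_mul_of_pos_right
      (Complex.real_lt_real.2 ((hf p hp).2.trans_le (min_le_right _ _))) (hg p hp).det_pos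
  refine ⟨⟨q, hq⟩, fun x => ?_⟩
  have h₁ : c * (φ₁ x - ψ₁ x) ≤ η / 2 :=
    (mul_le_mul_of_nonneg_left ((le_abs_self _).trans (hclose₁ x).le) hc).trans
      (mul_le_of_le_one_left (half_pos hη).le hc'.le)
  have h₂ : -(φ₂ x - ψ₂ x) ≤ η / 2 :=
    (neg_le_abs _).trans ((hclose₂ x).le.trans (min_le_left _ _))
  have hmax' := hmax x
  rw [← hbdry₁, ← hbdry₂]
  linarith

theorem boundary_nonempty (hg : ∀ p ∈ I.interior M, (g p).PosDef)
    (hφ : IsWeakMongeAmpereSolution I e g h φ) : Nonempty (I.boundary M) :=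
  (exists_mem_boundary_forall_mul_sub_le hg hφ hφ le_rfl one_pos one_pos).nonempty

theorem sub_le_of_forall_boundary (hg : ∀ p ∈ I.interior M, (g p).PosDef)
    (hφ₁ : IsWeakMongeAmpereSolution I e g h₁ φ₁) (hφ₂ : IsWeakMongeAmpereSolution I e g h₂ φ₂)
    {B : ℝ} (hB : ∀ q, h₁ q - h₂ q ≤ B) (p : M) : φ₁ p - φ₂ p ≤ B := by
  obtain ⟨K, hK⟩ := isCompact_univ.exists_bound_of_continuousOn hφ₁.continuous.continuousOn
  have hK' (x : M) : |φ₁ x| ≤ K := hK x (mem_univ x)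
  have hbound : ∀ᶠ δ in 𝓝[>] (0 : ℝ), φ₁ p - φ₂ p ≤ B + δ * (2 * K + 1) := by
    filter_upwards [Ioo_mem_nhdsGT one_pos] with δ hδ
    obtain ⟨q, hq⟩ := exists_mem_boundary_forall_mul_sub_le hg hφ₁ hφ₂
      (sub_nonneg.2 hδ.2.le) (sub_lt_self 1 hδ.1) hδ.1
    have hp : δ * φ₁ p ≤ δ * K :=
      mul_le_mul_of_nonneg_left ((le_abs_self _).trans (hK' p)) hδ.1.le
    have hq' : δ * -h₁ q ≤ δ * K :=
      mul_le_mul_of_nonneg_left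
        (hφ₁.eq_boundaryData q ▸ (neg_le_abs _).trans (hK' q)) hδ.1.le
    linarith [hq p, hB q]
  have hlim : Filter.Tendsto (fun δ => B + δ * (2 * K + 1)) (𝓝[>] 0) (𝓝 B) := by
    have hcont : Continuous fun δ => B + δ * (2 * K + 1) := by fun_prop
    simpa using (hcont.tendsto 0).mono_left nhdsWithin_le_nhds
  exact ge_of_tendsto hlim hbound

theorem abs_sub_le_of_forall_boundary (hg : ∀ p ∈ I.interior M, (g p).PosDef)
    (hφ₁ : IsWeakMongeAmpereSolution I e g h₁ φ₁) (hφ₂ : IsWeakMongeAmpereSolution I e g h₂ φ₂)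
    {B : ℝ} (hB : ∀ q, |h₁ q - h₂ q| ≤ B) (p : M) : |φ₁ p - φ₂ p| ≤ B :=
  abs_sub_le_iff.2 ⟨sub_le_of_forall_boundary hg hφ₁ hφ₂ (fun q => (abs_sub_le_iff.1 (hB q)).1) p,
    sub_le_of_forall_boundary hg hφ₂ hφ₁ (fun q => (abs_sub_le_iff.1 (hB q)).2) p⟩

theorem unique (hg : ∀ p ∈ I.interior M, (g p).PosDef)
    (hφ₁ : IsWeakMongeAmpereSolution I e g h φ₁) (hφ₂ : IsWeakMongeAmpereSolution I e g h φ₂) :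
    φ₁ = φ₂ := by
  ext p
  refine sub_eq_zero.1 (abs_nonpos_iff.1 ?_)
  exact abs_sub_le_of_forall_boundary hg hφ₁ hφ₂ (fun q => by simp) p

end IsWeakMongeAmpereSolution

theorem theorem4_general [CompactSpace M] [Nonempty M] [IsManifold I 1 M]
    (hg : ∀ p ∈ I.interior M, (g p).PosDef) :
    (∀ (h₁ h₂ : I.boundary M → ℝ) (φ₁ φ₂ : M → ℝ),
      IsWeakMongeAmpereSolution I e g h₁ φ₁ → IsWeakMongeAmpereSolution I e g h₂ φ₂ →
      ∃ m m' : ℝ,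
        IsGreatest (range fun p => |φ₁ p - φ₂ p|) m ∧
        IsGreatest (range fun q => |h₁ q - h₂ q|) m' ∧ m ≤ m') ∧
    (∀ (h : I.boundary M → ℝ) (φ₁ φ₂ : M → ℝ),
      IsWeakMongeAmpereSolution I e g h φ₁ → IsWeakMongeAmpereSolution I e g h φ₂ → φ₁ = φ₂) := by
  refine ⟨fun h₁ h₂ φ₁ φ₂ hφ₁ hφ₂ => ?_, fun h φ₁ φ₂ hφ₁ hφ₂ => hφ₁.unique hg hφ₂⟩
  have : Nonempty (I.boundary M) := hφ₁.boundary_nonempty hg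
  have : CompactSpace (I.boundary M) :=
    isCompact_iff_compactSpace.1 (I.isClosed_boundary one_ne_zero).isCompact
  have hcont : Continuous fun x => |φ₁ x - φ₂ x| := (hφ₁.continuous.sub hφ₂.continuous).abs
  have hcont' : Continuous fun q => |h₁ q - h₂ q| :=
    (hcont.comp continuous_subtype_val).congr fun q => by
      rw [Function.comp_apply, hφ₁.eq_boundaryData, hφ₂.eq_boundaryData]
  obtain ⟨m, hm⟩ := (isCompact_range hcont).exists_isGreatest (range_nonempty _)
  obtain ⟨m', hm'⟩ := (isCompact_range hcont').exists_isGreatest (range_nonempty _)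
  obtain ⟨p, rfl⟩ := hm.1
  exact ⟨_, m', hm, hm', hφ₁.abs_sub_le_of_forall_boundary hg hφ₂ (fun q => hm'.2 ⟨q, rfl⟩) p⟩

end WeakSolution

section KahlerProduct

theorem KahlerMetric.form_self_pos {E H M : Type*} [NormedAddCommGroup E] [NormedSpace ℂ E]
    [TopologicalSpace H] {I : ModelWithCorners ℂ E H} [TopologicalSpace M] [ChartedSpace H M]
    (g : KahlerMetric I M) (x : M) {v : TangentSpace I x} (hv : v ≠ 0) : 0 < g.form x v v :=
  Complex.pos_iff.2 ⟨g.pos x v hv, (Complex.conj_eq_iff_im.1 (g.conj_symm x v v)).symm⟩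

theorem KahlerMetric.form_self_nonneg {E H M : Type*} [NormedAddCommGroup E] [NormedSpace ℂ E]
    [TopologicalSpace H] {I : ModelWithCorners ℂ E H} [TopologicalSpace M] [ChartedSpace H M]
    (g : KahlerMetric I M) (x : M) (v : TangentSpace I x) : 0 ≤ g.form x v v := by
  rcases eq_or_ne v 0 with rfl | hv
  · rw [map_zero]
  · exact (g.form_self_pos x hv).le

variable {n : ℕ}

theorem linearIndependent_coordVec : LinearIndependent ℂ (coordVec n) := by
  have h : coordVec n =
      (EuclideanSpace.basisFun (Fin n) ℂ).toBasis.prod (Module.Basis.singleton Unit ℂ) := by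
    ext a : 1
    rcases a with i | i <;> simp [coordVec]
  exact h ▸ Module.Basis.linearIndependent _

variable
  {V : Type*} [TopologicalSpace V] [ChartedSpace (EuclideanSpace ℂ (Fin n)) V]
  {R : Type*} [TopologicalSpace R] [ChartedSpace ClosedHalfPlane R]
  (gV : KahlerMetric 𝓘(ℂ, EuclideanSpace ℂ (Fin n)) V) (gR : KahlerMetric halfPlaneModel R)

/-- The product metric at `p` as a sesquilinear form on `ℂⁿ × ℂ`, the tangent space at `p` read
through the preferred chart. -/
def productForm (p : V × R) :
    EuclideanSpace ℂ (Fin n) × ℂ →ₗ[ℂ] EuclideanSpace ℂ (Fin n) × ℂ →ₗ⋆[ℂ] ℂ :=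
  (ContinuousLinearMap.bilinearComp
      (show EuclideanSpace ℂ (Fin n) →L[ℂ] EuclideanSpace ℂ (Fin n) →L⋆[ℂ] ℂ from gV.form p.1)
      (.fst ℂ _ ℂ) (.fst ℂ _ ℂ) +
    ContinuousLinearMap.bilinearComp (show ℂ →L[ℂ] ℂ →L⋆[ℂ] ℂ from gR.form p.2)
      (.snd ℂ _ ℂ) (.snd ℂ _ ℂ)).toLinearMap₁₂

theorem productForm_apply (p : V × R) (v w : EuclideanSpace ℂ (Fin n) × ℂ) :
    productForm gV gR p v w = gV.form p.1 v.1 w.1 + gR.form p.2 v.2 w.2 := rfl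

theorem posDef_metricMatrix (p : V × R) : (metricMatrix gV gR p).PosDef := by
  refine posDef_of_sesquilinear (Q := productForm gV gR p) (fun v w => ?_) (fun v hv => ?_)
    linearIndependent_coordVec
  · rw [productForm_apply, productForm_apply, map_add]
    exact congrArg₂ (· + ·) (gV.conj_symm p.1 v.1 w.1) (gR.conj_symm p.2 v.2 w.2)
  · rw [productForm_apply]
    rcases eq_or_ne v.1 0 with h₁ | h₁
    · have h₂ : v.2 ≠ 0 := fun h₂ => hv (Prod.ext h₁ h₂)
      exact add_pos_of_nonneg_of_pos (gV.form_self_nonneg p.1 v.1) (gR.form_self_pos p.2 h₂)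
    · exact add_pos_of_pos_of_nonneg (gV.form_self_pos p.1 h₁) (gR.form_self_nonneg p.2 v.2)

variable {gV gR}

theorem isStrictlyPSH_iff_isGeneralizedPSH {ψ : V × R → ℝ} :
    IsStrictlyPSH (productModel n) (coordVec n) (metricMatrix gV gR) ψ ↔
      IsGeneralizedPSH gV gR ψ :=
  ⟨fun h => ⟨h.continuous, h.contDiffAt, h.posDef⟩,
    fun h => ⟨h.continuous, h.contDiffAt, h.posDef⟩⟩

theorem isWeakMongeAmpereSolution_iff_isWeakC0Solution
    {h : (productModel n).boundary (V × R) → ℝ} {φ : V × R → ℝ} :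
    IsWeakMongeAmpereSolution (productModel n) (coordVec n) (metricMatrix gV gR) h φ ↔
      IsWeakC0Solution gV gR h φ := by
  simp only [IsWeakMongeAmpereSolution, isStrictlyPSH_iff_isGeneralizedPSH]
  rfl

end KahlerProduct

end

theorem theorem4 {n : ℕ}
    {V : Type*} [TopologicalSpace V] [T2Space V] [CompactSpace V] [Nonempty V]
    [ChartedSpace (EuclideanSpace ℂ (Fin n)) V]
    [IsManifold 𝓘(ℂ, EuclideanSpace ℂ (Fin n)) ∞ V]
    {R : Type*} [TopologicalSpace R] [T2Space R] [CompactSpace R]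
    [ChartedSpace ClosedHalfPlane R] [IsManifold halfPlaneModel ∞ R]
    (hR : (halfPlaneModel.boundary R).Nonempty)
    (gV : KahlerMetric 𝓘(ℂ, EuclideanSpace ℂ (Fin n)) V) (gR : KahlerMetric halfPlaneModel R) :
    (∀ (h₁ h₂ : (productModel n).boundary (V × R) → ℝ) (φ₁ φ₂ : V × R → ℝ),
      IsWeakC0Solution gV gR h₁ φ₁ → IsWeakC0Solution gV gR h₂ φ₂ →
      ∃ m m' : ℝ,
        IsGreatest (Set.range fun p : V × R => |φ₁ p - φ₂ p|) m ∧
        IsGreatest (Set.range fun q : (productModel n).boundary (V × R) => |h₁ q - h₂ q|) m' ∧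
        m ≤ m') ∧
    (∀ (h : (productModel n).boundary (V × R) → ℝ) (φ₁ φ₂ : V × R → ℝ),
      IsWeakC0Solution gV gR h φ₁ → IsWeakC0Solution gV gR h φ₂ → φ₁ = φ₂) := by
  have : IsManifold (productModel n) 1 (V × R) := .of_le (n := ∞) (by simp)
  have : Nonempty R := hR.to_type
  simpa only [isWeakMongeAmpereSolution_iff_isWeakC0Solution] using
    theorem4_general (I := productModel n) (e := coordVec n) fun p _ => posDef_metricMatrix gV gR p
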